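/- Let $\mathcal X$ be a measurable space and $\mathcal Y\subseteq\mathbb R$ a label space. Let $(\boldsymbol x,y,\underline y,\overline y)$ be a random element of $\mathcal X\times\mathcal Y^3$ with an arbitrary joint law such that $y\in S=[\underline y,\overline y]$ almost surely; write $p$ for the law of $(\boldsymbol x,y)$ and $\tilde p$ for the law of the interval example $(\boldsymbol x,S)$, i.e. of $(\boldsymbol x,\underline y,\overline y)$. Let $\mathcal F$ be a class of measurable functions $f:\mathcal X\to\mathbb R$. For a measurable loss $\ell:\mathbb R\times\mathbb R\to[0,\infty)$ let $f^\star\in\mathcal F$ be a minimizer over $\mathcal F$ of the ordinary risk $R(f)=\mathbb E_{p}[\ell(f(\boldsymbol x),y)]\in[0,\infty]$. Put $$\psi(f(\boldsymbol x),S)=\max(0,\underline y-f(\boldsymbol x))+\max(0,f(\boldsymbol x)-\overline y),\qquad R^\psi(f)=\mathbb E_{\tilde p}[\psi(f(\boldsymbol x),S)].$$ Assume that there are constants $M,M'$ such that, for $\tilde p$-almost every $(\boldsymbol x,S)$ and all $f\in\mathcal F$, $\max(\underline y-f(\boldsymbol x),0)\le M$ and $\max(f(\boldsymbol x)-\overline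 y,0)\le M'$. Assume that the classes $$\{(\boldsymbol x,\underline y)\mapsto\max(\underline y-f(\boldsymbol x),0)\mid f\in\mathcal F\},\qquad \{(\boldsymbol x,\overline y)\mapsto\max(f(\boldsymbol x)-\overline y,0)\mid f\in\mathcal F\}$$ of functions on $\mathcal X\times\mathcal Y$ have finite pseudo-dimensions $d$ and $d'$. (The pseudo-dimension of a class $G$ of real functions on $Z$ is the largest $m$ for which there are distinct points $z_1,\dots,z_m\in Z$ and thresholds $t_1,\dots,t_m\in\mathbb R$ such that for every $B\subseteq\{1,\dots,m\}$ some $g\in G$ satisfies $g(z_i)>t_i\iff i\in B$ for all $i$.) As usual in uniform convergence results, suprema over $\mathcal F$ are assumed measurable: for $L_f=\max(\underline y-f(\boldsymbol x),0)$, and likewise for $L_f=\max(f(\boldsymbol x)-\overline y,0)$, and for all $m\ge 0$, $a_1,\dots,a_m,c,t\in\mathbb R$, the set of $(z_1,\dots,z_m)$ for which some $f\in\mathcal F$ has $c\,\mathbb E_{\tilde p}[L_f]+\sum_{i=1}^m a_iL_f(z_i)>t$ is measurable with respect to the completion of $\tilde p^{\otimes m}$. (This holds, for instance, if $\mathcal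 F$ is countable.) Let $n\ge 1$ with $n\ge d$ and $n\ge d'$, let $(\boldsymbol x_1,S_1),\dots,(\boldsymbol x_n,S_n)$ be independent with law $\tilde p$, and let $\widehat f$ be, for almost every sample, a minimizer over $\mathcal F$ of the empirical risk $\widehat R^\psi(f)=\sum_{i=1}^n\psi(f(\boldsymbol x_i),S_i)$. Then, for every $\delta\in(0,1)$, with probability at least $1-\delta$ over the sample, $$R^\psi(\widehat f)-R^\psi(f^\star)\le 2M\sqrt{\frac{2d\log\frac{en}{d}}{n}}+2M'\sqrt{\frac{2d'\log\frac{en}{d'}}{n}}+2(M+M')\sqrt{\frac{\log\frac4\delta}{2n}},$$ where $0\log\frac{en}{0}:=0$. (If the event is not measurable, this means that its complement has outer probability at most $\delta$.) -/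

import Mathlib

open MeasureTheory
open scoped NNReal ENNReal

/-- A finite set `s` of points is pseudo-shattered by the class `G` of real functions: for suitable
thresholds `t z` (`z ∈ s`), every subset of `s` is cut out by `g z > t z` for some `g ∈ G`. -/
def PseudoShatters {Z : Type*} (G : Set (Z → ℝ)) (s : Finset Z) : Prop :=
  ∃ t : Z → ℝ, ∀ b ⊆ s, ∃ g ∈ G, ∀ z ∈ s, t z < g z ↔ z ∈ b

/-- The pseudo-dimension of a class of real functions: the largest number of points
that it pseudo-shatters (`⊤` if there is no largest one). -/
noncomputable def pseudoDim {Z : Type*} (G : Set (Z → ℝ)) : ℕ∞ :=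
  ⨆ (s : Finset Z) (_ : PseudoShatters G s), (s.card : ℕ∞)

/-- The function `(x, l) ↦ max (l - f x) 0`, where `l` is a left endpoint. -/
noncomputable def leftLoss {X : Type*} {Y : Set ℝ} (f : X → ℝ) : X × Y → ℝ :=
  fun z => max ((z.2 : ℝ) - f z.1) 0

/-- The function `(x, r) ↦ max (f x - r) 0`, where `r` is a right endpoint. -/
noncomputable def rightLoss {X : Type*} {Y : Set ℝ} (f : X → ℝ) : X × Y → ℝ :=
  fun z => max (f z.1 - (z.2 : ℝ)) 0

/-- The surrogate loss of the limiting method, of a prediction `u` on the interval `[l, r]`. -/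
noncomputable def surrogateLoss (u l r : ℝ) : ℝ :=
  max 0 (l - u) + max 0 (u - r)

/-- The law of a labelled example `(x, y)`, when `(x, y, l, r)` has law `P`. -/
noncomputable def labelledLaw {X : Type*} [MeasurableSpace X] {Y : Set ℝ}
    (P : Measure (X × Y × Y × Y)) : Measure (X × Y) :=
  P.map fun w => (w.1, w.2.1)

/-- The law of an interval example `(x, [l, r])`, when `(x, y, l, r)` has law `P`. -/
noncomputable def intervalLaw {X : Type*} [MeasurableSpace X] {Y : Set ℝ}
    (P : Measure (X × Y × Y × Y)) : Measure (X × Y × Y) :=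
  P.map fun w => (w.1, w.2.2)

/-- The ordinary expected risk of `f` for the nonnegative loss `loss`, under the law `p` of
the labelled examples. -/
noncomputable def expectedRisk {X : Type*} [MeasurableSpace X] {Y : Set ℝ}
    (loss : ℝ → ℝ → ℝ≥0) (p : Measure (X × Y)) (f : X → ℝ) : ℝ≥0∞ :=
  ∫⁻ w, (loss (f w.1) (w.2 : ℝ) : ℝ≥0∞) ∂p

/-- The expected risk of `f` for the surrogate loss, under the law `q` of the interval examples. -/
noncomputable def surrogateRisk {X : Type*} [MeasurableSpace X] {Y : Set ℝ}
    (q : Measure (X × Y × Y)) (f : X → ℝ) : ℝ :=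
  ∫ z, surrogateLoss (f z.1) (z.2.1 : ℝ) (z.2.2 : ℝ) ∂q

/-- The empirical risk of `f` for the surrogate loss, on the sample `z`. -/
noncomputable def empiricalSurrogateRisk {X : Type*} {Y : Set ℝ} {n : ℕ}
    (z : Fin n → X × Y × Y) (f : X → ℝ) : ℝ :=
  ∑ i, surrogateLoss (f (z i).1) ((z i).2.1 : ℝ) ((z i).2.2 : ℝ)

/-- The usual measurability convention for suprema over a (possibly uncountable) class `F` of
models with losses `L f`, `f ∈ F`: on finite samples, a supremum over `F` of a linear combination of
the true risk of `f` and of the losses of `f` at the sample points is measurable with respect to the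
completion of the product measure. It is stated through the sets where the supremum exceeds `t`. -/
def SupMeasurable {H Z : Type*} [MeasurableSpace Z] (q : Measure Z) (F : Set H)
    (L : H → Z → ℝ) : Prop :=
  ∀ (m : ℕ) (a : Fin m → ℝ) (c t : ℝ),
    NullMeasurableSet
      {z : Fin m → Z | ∃ f ∈ F, t < c * ∫ w, L f w ∂q + ∑ i, a i * L f (z i)}
      (Measure.pi fun _ => q)

/-! The surrogate loss is the sum of a left and a right loss, so the excess risk of the empirical
minimizer splits into four one-sided deviations: for each loss, the risk of `fhat` above its
empirical value, and the empirical value of `fstar` above its risk. The comparison of the two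
empirical values is favourable because `fhat` minimizes the empirical risk. Each deviation gets
failure probability δ/4.

The model `fstar` is fixed, so its two deviations are plain Hoeffding bounds. The model `fhat`
depends on the sample, so its two deviations are bounded uniformly over `F`: McDiarmid's inequality
(`measure_ge_le_of_bounded_differences`) concentrates the supremum about its mean, and
symmetrization (`integral_supLoss_le`) bounds this mean by twice a Rademacher average.

For the Rademacher average, a loss with values in [0, M] is an integral over levels t of the
indicators of its superlevel sets. At one level these sets shatter at most as many points as the
pseudo-dimension allows, so Sauer-Shelah counts them and Massart's lemma applies. Integrating over t
costs a factor M and avoids chaining. -/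

/-- The sign `±1` encoded by a Boolean. -/
def boolSign (b : Bool) : ℝ := if b then 1 else -1

/-! ### Counting: the Sauer-Shelah bound -/

/-- The binomial sum in the Sauer-Shelah lemma is at most `(e n / d) ^ d`. -/
theorem sum_choose_le_exp {n d : ℕ} (hdn : d ≤ n) :
    ((∑ k ∈ Finset.Iic d, n.choose k : ℕ) : ℝ) ≤
      Real.exp (d * Real.log (Real.exp 1 * n / d)) := by
  rcases Nat.eq_zero_or_pos d with rfl | hd
  -- For d = 0 the exponent is 0 whatever the logarithm of the quotient by zero is, and both sides
  -- are 1.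
  · have : Finset.Iic 0 = ({0} : Finset ℕ) := by ext; simp
    simp [this]
  have hd' : (0 : ℝ) < d := by exact_mod_cast hd
  have hn' : (0 : ℝ) < n := by exact_mod_cast hd.trans_le hdn
  have hx1 : (d / n : ℝ) ≤ 1 := by
    rw [div_le_one hn']; exact_mod_cast hdn
  have hx0 : (0 : ℝ) < d / n := by positivity
  -- Since d/n ≤ 1, lowering the power from d to k only enlarges the terms; the binomial theorem and
  -- 1 + u ≤ exp u then give exp d.
  have key : (d / n : ℝ) ^ d * ((∑ k ∈ Finset.Iic d, n.choose k : ℕ) : ℝ) ≤ Real.exp d := by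
    calc (d / n : ℝ) ^ d * ((∑ k ∈ Finset.Iic d, n.choose k : ℕ) : ℝ)
        = ∑ k ∈ Finset.Iic d, (d / n : ℝ) ^ d * n.choose k := by
          push_cast; rw [Finset.mul_sum]
      _ ≤ ∑ k ∈ Finset.Iic d, (d / n : ℝ) ^ k * n.choose k := by
          refine Finset.sum_le_sum fun k hk => ?_
          have := pow_le_pow_of_le_one hx0.le hx1 (Finset.mem_Iic.1 hk)
          gcongr
      _ ≤ ∑ k ∈ Finset.range (n + 1), (d / n : ℝ) ^ k * n.choose k := by
          refine Finset.sum_le_sum_of_subset_of_nonneg (fun k hk => ?_) fun _ _ _ => by positivity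
          have := Finset.mem_Iic.1 hk
          simp only [Finset.mem_range]; omega
      _ = (d / n + 1 : ℝ) ^ n := by rw [add_pow]; simp
      _ ≤ (Real.exp (d / n)) ^ n := by
          gcongr; exact Real.add_one_le_exp _
      _ = Real.exp d := by
          rw [← Real.exp_nat_mul]; congr 1; field_simp
  have h2 : Real.exp (d * Real.log (Real.exp 1 * n / d)) = Real.exp d / (d / n : ℝ) ^ d := by
    rw [Real.exp_nat_mul, Real.exp_log (by positivity), div_pow, div_pow, mul_pow, ← Real.exp_nat_mul]
    simp only [mul_one]
    field_simp
  rw [h2, le_div_iff₀ (by positivity), mul_comm]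
  exact key

/-- A family of finite sets that shatters no set of more than `d` points has at most
`(e n / d) ^ d` members. -/
theorem card_le_exp_of_shatters {ι : Type*} [Fintype ι] [DecidableEq ι] {d : ℕ}
    (hd : d ≤ Fintype.card ι) (A : Finset (Finset ι))
    (hA : ∀ s, A.Shatters s → s.card ≤ d) :
    (A.card : ℝ) ≤ Real.exp (d * Real.log (Real.exp 1 * (Fintype.card ι) / d)) := by
  refine le_trans ?_ (sum_choose_le_exp hd)
  norm_cast
  refine (A.card_le_card_shatterer.trans Finset.card_shatterer_le_sum_vcDim).trans ?_
  refine Finset.sum_le_sum_of_subset (Finset.Iic_subset_Iic.2 ?_)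
  exact Finset.sup_le fun s hs => hA s (Finset.mem_shatterer.1 hs)

/-! ### Rademacher averages of classes of sets -/

/-- The Rademacher moment generating function of the indicator of a set. -/
theorem sum_exp_boolSign_le {ι : Type*} [Fintype ι] [DecidableEq ι] (s : ℝ) (B : Finset ι) :
    ∑ σ : ι → Bool, Real.exp (s * ∑ i ∈ B, boolSign (σ i)) ≤
      2 ^ Fintype.card ι * Real.exp (Fintype.card ι * (s ^ 2 / 2)) := by
  have h1 : ∀ σ : ι → Bool, Real.exp (s * ∑ i ∈ B, boolSign (σ i)) =
      ∏ i, Real.exp (if i ∈ B then s * boolSign (σ i) else 0) := by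
    intro σ
    rw [← Real.exp_sum, Finset.mul_sum, Finset.sum_ite_mem, Finset.univ_inter]
  simp_rw [h1]
  rw [← Fintype.piFinset_univ, ← Finset.prod_univ_sum (fun _ => Finset.univ)
    (fun i b => Real.exp (if i ∈ B then s * boolSign b else 0))]
  -- Coordinates in B give 2 cosh s, the others give 2; both are at most 2 exp(s²/2), so the bound
  -- is uniform in B.
  have h2 : ∀ i, ∑ b : Bool, Real.exp (if i ∈ B then s * boolSign b else 0) ≤
      2 * Real.exp (s ^ 2 / 2) := by
    intro i
    by_cases hi : i ∈ B
    · have := Real.cosh_le_exp_half_sq s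
      rw [Real.cosh_eq] at this
      simp only [hi, if_true, Fintype.sum_bool, boolSign, mul_one]
      simp
      linarith
    · simp only [hi, if_false, Real.exp_zero, Finset.sum_const, Finset.card_univ, Fintype.card_bool, nsmul_eq_mul]
      norm_num
      positivity
  calc _ ≤ ∏ _i : ι, 2 * Real.exp (s ^ 2 / 2) :=
        Finset.prod_le_prod (fun i _ => Finset.sum_nonneg fun _ _ => (Real.exp_pos _).le)
          fun i _ => h2 i
    _ = _ := by
        rw [Finset.prod_const, mul_pow, ← Real.exp_nat_mul]; simp [Finset.card_univ]

/-- Optimizing the free parameter of a Chernoff bound. -/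
theorem le_sqrt_of_forall_chernoff {x l m : ℝ} (hl : 0 ≤ l) (hm : 0 ≤ m)
    (h : ∀ s : ℝ, 0 < s → s * x ≤ l + m * (s ^ 2 / 2)) : x ≤ √(2 * m * l) := by
  by_contra! hx
  have hx0 : 0 < x := (Real.sqrt_nonneg _).trans_lt hx
  have hx2 : 2 * m * l < x ^ 2 := (Real.sqrt_lt' hx0).1 hx
  rcases hm.eq_or_lt with rfl | hm
  · have := h ((l + 1) / x) (by positivity)
    rw [div_mul_cancel₀ _ hx0.ne'] at this
    linarith
  -- The minimizer s = x/m of the quadratic gives x² ≤ 2ml.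
  · have := h (x / m) (by positivity)
    field_simp at this
    nlinarith

/-- **Massart's finite class lemma**, for a class of sets and an arbitrary selection from it. -/
theorem sum_boolSign_le_of_card_le {ι : Type*} [Fintype ι] [DecidableEq ι]
    {A : Finset (Finset ι)} {l : ℝ} (hl : 0 ≤ l) (hA : (A.card : ℝ) ≤ Real.exp l)
    (B : (ι → Bool) → Finset ι) (hB : ∀ σ, B σ ∈ A) :
    ∑ σ, ∑ i ∈ B σ, boolSign (σ i) ≤ 2 ^ Fintype.card ι * √(2 * Fintype.card ι * l) := by
  have hN : (0 : ℝ) < 2 ^ Fintype.card ι := by positivity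
  rw [← div_le_iff₀' hN]
  refine le_sqrt_of_forall_chernoff hl (by positivity) fun s _ => ?_
  set k := l + Fintype.card ι * (s ^ 2 / 2)
  have h1 : ∑ σ : ι → Bool, Real.exp (s * ∑ i ∈ B σ, boolSign (σ i)) ≤
      2 ^ Fintype.card ι * Real.exp k := by
    calc ∑ σ : ι → Bool, Real.exp (s * ∑ i ∈ B σ, boolSign (σ i))
        ≤ ∑ σ : ι → Bool, ∑ b ∈ A, Real.exp (s * ∑ i ∈ b, boolSign (σ i)) :=
          Finset.sum_le_sum fun σ _ => Finset.single_le_sum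
            (f := fun b => Real.exp (s * ∑ i ∈ b, boolSign (σ i)))
            (fun b _ => (Real.exp_pos _).le) (hB σ)
      _ = ∑ b ∈ A, ∑ σ : ι → Bool, Real.exp (s * ∑ i ∈ b, boolSign (σ i)) := Finset.sum_comm
      _ ≤ ∑ _b ∈ A, 2 ^ Fintype.card ι * Real.exp (Fintype.card ι * (s ^ 2 / 2)) :=
          Finset.sum_le_sum fun b _ => sum_exp_boolSign_le s b
      _ = A.card * (2 ^ Fintype.card ι * Real.exp (Fintype.card ι * (s ^ 2 / 2))) := by simp
      _ ≤ Real.exp l * (2 ^ Fintype.card ι * Real.exp (Fintype.card ι * (s ^ 2 / 2))) := by gcongr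
      _ = _ := by rw [Real.exp_add]; ring
  -- The tangent inequality u + 1 ≤ exp u replaces Jensen: k is chosen so that the terms exp(u) on
  -- the right average to at most 1.
  have h2 : ∑ σ : ι → Bool, (s * ∑ i ∈ B σ, boolSign (σ i) - k + 1) ≤
      ∑ σ : ι → Bool, Real.exp (s * ∑ i ∈ B σ, boolSign (σ i)) * Real.exp (-k) := by
    refine Finset.sum_le_sum fun σ _ => ?_
    rw [← Real.exp_add]
    exact Real.add_one_le_exp _
  rw [← Finset.sum_mul] at h2
  have h3 : (∑ σ : ι → Bool, Real.exp (s * ∑ i ∈ B σ, boolSign (σ i))) * Real.exp (-k) ≤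
      2 ^ Fintype.card ι := by
    calc _ ≤ 2 ^ Fintype.card ι * Real.exp k * Real.exp (-k) := by gcongr
      _ = _ := by rw [mul_assoc, ← Real.exp_add]; simp
  have h4 := h2.trans h3
  rw [Finset.sum_add_distrib, Finset.sum_sub_distrib, ← Finset.mul_sum] at h4
  simp only [Finset.sum_const, Finset.card_univ, Fintype.card_fun, Fintype.card_bool, nsmul_eq_mul,
    Nat.cast_pow, Nat.cast_ofNat, mul_one] at h4
  rw [mul_div_assoc', div_le_iff₀ hN]
  linarith

/-! ### From sets to functions: integration over levels -/

/-- Layer-cake formula. Leaving out the level M matters later: truncating a loss at M does not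
change its superlevel sets at levels t < M. -/
theorem setIntegral_ite_lt {v M : ℝ} (h0 : 0 ≤ v) (hM : v ≤ M) :
    ∫ t in Set.Ico 0 M, (if t < v then (1 : ℝ) else 0) = v := by
  have : (fun t : ℝ => if t < v then (1 : ℝ) else 0) = (Set.Iio v).indicator 1 := by
    ext t; simp [Set.indicator_apply]
  rw [this, integral_indicator_one measurableSet_Iio, measureReal_restrict_apply measurableSet_Iio]
  have : Set.Iio v ∩ Set.Ico 0 M = Set.Ico 0 v := by
    ext t; simp only [Set.mem_inter_iff, Set.mem_Iio, Set.mem_Ico]; constructor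
    · rintro ⟨a, b, c⟩; exact ⟨b, a⟩
    · rintro ⟨a, b⟩; exact ⟨b, a, b.trans_le hM⟩
  simp [this, h0]

theorem integrableOn_ite_lt (v M : ℝ) :
    IntegrableOn (fun t : ℝ => if t < v then (1 : ℝ) else 0) (Set.Ico 0 M) := by
  have : (fun t : ℝ => if t < v then (1 : ℝ) else 0) = (Set.Iio v).indicator 1 := by
    ext t; simp [Set.indicator_apply]
  rw [this]
  exact (integrableOn_const (C := (1 : ℝ)) (by simp)).indicator measurableSet_Iio

/-- The bound on the empirical Rademacher complexity of a `[0, M]`-valued class whose superlevel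
sets, at each fixed level, shatter no more than `d` points. It is stated for the values `v σ` of
an arbitrary selection of members of the class, one for each sign vector `σ`. -/
theorem sum_boolSign_mul_le {ι : Type*} [Fintype ι] [DecidableEq ι] {M : ℝ} (hM : 0 ≤ M) {d : ℕ}
    (hd : d ≤ Fintype.card ι) (v : (ι → Bool) → ι → ℝ) (hv0 : ∀ σ i, 0 ≤ v σ i)
    (hvM : ∀ σ i, v σ i ≤ M)
    (hsh : ∀ t : ℝ, 0 ≤ t → t < M → ∀ s : Finset ι,
      (∀ b ⊆ s, ∃ σ, ∀ i ∈ s, t < v σ i ↔ i ∈ b) → s.card ≤ d) :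
    ∑ σ, ∑ i, boolSign (σ i) * v σ i ≤ 2 ^ Fintype.card ι *
      (M * √(2 * Fintype.card ι * (d * Real.log (Real.exp 1 * Fintype.card ι / d)))) := by
  set l : ℝ := d * Real.log (Real.exp 1 * Fintype.card ι / d)
  have hl : 0 ≤ l := by
    rcases Nat.eq_zero_or_pos d with h | h
    · simp [l, h]
    · refine mul_nonneg (by positivity) (Real.log_nonneg ?_)
      have h1 : (d : ℝ) ≤ Fintype.card ι := by exact_mod_cast hd
      have h2 : (0 : ℝ) < d := by exact_mod_cast h
      rw [le_div_iff₀ h2]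
      have := Real.add_one_le_exp 1
      nlinarith
  set K : ℝ := 2 ^ Fintype.card ι * √(2 * Fintype.card ι * l)
  have hpt : ∀ t ∈ Set.Ico 0 M,
      ∑ σ, ∑ i, boolSign (σ i) * (if t < v σ i then (1 : ℝ) else 0) ≤ K := by
    rintro t ⟨ht0, htM⟩
    let B : (ι → Bool) → Finset ι := fun σ => Finset.univ.filter fun i => t < v σ i
    -- Only the superlevel sets of the selected members have to be counted, so the class itself may
    -- be infinite.
    have hcard : ((Finset.univ.image B).card : ℝ) ≤ Real.exp l := by
      refine card_le_exp_of_shatters hd _ fun s hs => hsh t ht0 htM s fun b hb => ?_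
      obtain ⟨u, hu, hsu⟩ := hs hb
      obtain ⟨σ, -, rfl⟩ := Finset.mem_image.1 hu
      refine ⟨σ, fun i hi => ?_⟩
      rw [← hsu]
      simp [B, hi]
    have := sum_boolSign_le_of_card_le hl hcard B fun σ =>
      Finset.mem_image_of_mem _ (Finset.mem_univ _)
    simpa only [B, Finset.sum_filter, mul_ite, mul_one, mul_zero] using this
  have hint : ∀ σ i, IntegrableOn
      (fun t => boolSign (σ i) * (if t < v σ i then (1 : ℝ) else 0)) (Set.Ico 0 M) :=
    fun σ i => (integrableOn_ite_lt _ _).const_mul _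
  calc ∑ σ, ∑ i, boolSign (σ i) * v σ i
      = ∑ σ, ∑ i, ∫ t in Set.Ico 0 M, boolSign (σ i) * (if t < v σ i then (1 : ℝ) else 0) := by
        refine Finset.sum_congr rfl fun σ _ => Finset.sum_congr rfl fun i _ => ?_
        rw [integral_const_mul, setIntegral_ite_lt (hv0 σ i) (hvM σ i)]
    _ = ∫ t in Set.Ico 0 M, ∑ σ, ∑ i, boolSign (σ i) * (if t < v σ i then (1 : ℝ) else 0) := by
        rw [integral_finsetSum _ fun σ _ => integrable_finsetSum _ fun i _ => hint σ i]
        refine Finset.sum_congr rfl fun σ _ => ?_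
        rw [integral_finsetSum _ fun i _ => hint σ i]
    _ ≤ ∫ _t in Set.Ico 0 M, K :=
        setIntegral_mono_on
          (integrable_finsetSum _ fun σ _ => integrable_finsetSum _ fun i _ => hint σ i)
          (integrableOn_const (by simp)) measurableSet_Ico hpt
    _ = _ := by simp [hM, K]; ring

/-! ### Concentration: McDiarmid's inequality -/

open ProbabilityTheory in
/-- Hoeffding's lemma for a function whose values differ by at most `c`. -/
theorem integral_exp_sub_integral_le_of_forall_le_add {Z : Type*} [MeasurableSpace Z]
    {q : Measure Z} [IsProbabilityMeasure q] {c : ℝ} {φ : Z → ℝ} (hφ : AEMeasurable φ q)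
    (hc : ∀ x y, φ x ≤ φ y + c) (t : ℝ) :
    ∫ x, Real.exp (t * (φ x - ∫ y, φ y ∂q)) ∂q ≤ Real.exp ((c / 2) ^ 2 * t ^ 2 / 2) := by
  obtain ⟨x₀⟩ : Nonempty Z := q.nonempty_of_neZero
  have hbdd : BddBelow (Set.range φ) :=
    ⟨φ x₀ - c, by rintro _ ⟨y, rfl⟩; linarith [hc x₀ y]⟩
  have hmem : ∀ x, φ x ∈ Set.Icc (⨅ y, φ y) ((⨅ y, φ y) + c) := fun x =>
    ⟨ciInf_le hbdd x, by
      have : Nonempty Z := ⟨x₀⟩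
      have : φ x - c ≤ ⨅ y, φ y := le_ciInf fun y => by linarith [hc x y]
      linarith⟩
  have h := (hasSubgaussianMGF_of_mem_Icc hφ (Filter.Eventually.of_forall hmem)).mgf_le t
  simpa [mgf, div_pow] using h

theorem Integrable.of_nonneg_of_le {Ω : Type*} [MeasurableSpace Ω] {μ : Measure Ω}
    [IsFiniteMeasure μ] {f : Ω → ℝ} {K : ℝ} (hf : AEMeasurable f μ) (h0 : ∀ x, 0 ≤ f x)
    (hK : ∀ x, f x ≤ K) : Integrable f μ :=
  Integrable.of_mem_Icc 0 K hf (Filter.Eventually.of_forall fun x => ⟨h0 x, hK x⟩)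

/-- The moment generating function bound behind **McDiarmid's inequality**. -/
theorem integral_exp_sub_integral_le_of_bounded_differences {Z : Type*} [MeasurableSpace Z]
    {q : Measure Z} [IsProbabilityMeasure q] {c K : ℝ} (t : ℝ) :
    ∀ (n : ℕ) (Φ : (Fin n → Z) → ℝ), AEMeasurable Φ (Measure.pi fun _ => q) →
      (∀ z, 0 ≤ Φ z) → (∀ z, Φ z ≤ K) → (∀ z i w, Φ z ≤ Φ (Function.update z i w) + c) →
      ∫ z, Real.exp (t * (Φ z - ∫ y, Φ y ∂(Measure.pi fun _ => q))) ∂(Measure.pi fun _ => q) ≤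
        Real.exp (n * ((c / 2) ^ 2 * t ^ 2 / 2)) := by
  obtain ⟨x₀⟩ : Nonempty Z := q.nonempty_of_neZero
  intro n
  induction n with
  | zero =>
    intro Φ _ _ _ _
    have : ∀ z, Φ z = Φ default := fun z => congrArg Φ (Subsingleton.elim _ _)
    simp [this]
  | succ n ih =>
    intro Φ hΦ h0 hK hc
    set μ : Measure (Fin n → Z) := Measure.pi fun _ => q
    set e := MeasurableEquiv.piFinSuccAbove (fun _ : Fin (n + 1) => Z) 0
    have he : MeasurePreserving e.symm (q.prod μ) (Measure.pi fun _ => q) :=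
      (measurePreserving_piFinSuccAbove (fun _ : Fin (n + 1) => q) 0).symm e
    have hes : ∀ x r, e.symm (x, r) = Fin.cons x r := fun x r => by
      ext i; simp [e, MeasurableEquiv.piFinSuccAbove]
    set Ψ : Z × (Fin n → Z) → ℝ := fun p => Φ (e.symm p)
    have hΨ : AEMeasurable Ψ (q.prod μ) := hΦ.comp_quasiMeasurePreserving he.quasiMeasurePreserving
    have hΨ0 : ∀ p, 0 ≤ Ψ p := fun p => h0 _
    have hΨK : ∀ p, Ψ p ≤ K := fun p => hK _
    have hΨ1 : ∀ x y r, Ψ (x, r) ≤ Ψ (y, r) + c := fun x y r => by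
      have := hc (e.symm (x, r)) 0 y
      simpa [Ψ, hes, Fin.update_cons_zero] using this
    have hΨ2 : ∀ x r i w, Ψ (x, r) ≤ Ψ (x, Function.update r i w) + c := fun x r i w => by
      have := hc (e.symm (x, r)) i.succ w
      simpa [Ψ, hes, Fin.cons_update] using this
    -- The mean over the first coordinate is taken as a lower Lebesgue integral: its bounds and
    -- bounded differences then hold for every r, although sections of Ψ are known to be measurable
    -- only for almost every r.
    set G : (Fin n → Z) → ℝ≥0∞ := fun r => ∫⁻ x, ENNReal.ofReal (Ψ (x, r)) ∂q
    have hGK : ∀ r, G r ≤ ENNReal.ofReal K := fun r => by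
      calc G r ≤ ∫⁻ _x, ENNReal.ofReal K ∂q :=
            lintegral_mono fun x => ENNReal.ofReal_le_ofReal (hΨK _)
        _ = _ := by simp
    have hGtop : ∀ r, G r ≠ ⊤ := fun r => ne_top_of_le_ne_top ENNReal.ofReal_ne_top (hGK r)
    have hK0 : 0 ≤ K := (h0 fun _ => x₀).trans (hK _)
    set g : (Fin n → Z) → ℝ := fun r => (G r).toReal
    have hg : AEMeasurable g μ := (hΨ.ennreal_ofReal.lintegral_prod_left').ennreal_toReal
    have hg0 : ∀ r, 0 ≤ g r := fun r => ENNReal.toReal_nonneg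
    have hgK : ∀ r, g r ≤ K := fun r => ENNReal.toReal_le_of_le_ofReal hK0 (hGK r)
    have hgc : ∀ r i w, g r ≤ g (Function.update r i w) + c := by
      intro r i w
      have hc0 : 0 ≤ c := by
        have := hΨ1 x₀ x₀ r; linarith
      have h1 : G r ≤ G (Function.update r i w) + ENNReal.ofReal c := by
        calc G r ≤ ∫⁻ x, (ENNReal.ofReal (Ψ (x, Function.update r i w)) + ENNReal.ofReal c) ∂q := by
              refine lintegral_mono fun x => ?_
              rw [← ENNReal.ofReal_add (hΨ0 _) hc0]
              exact ENNReal.ofReal_le_ofReal (hΨ2 x r i w)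
          _ = _ := by rw [lintegral_add_right _ measurable_const]; simp [G]
      have h2 := ENNReal.toReal_mono (by simp [hGtop]) h1
      rwa [ENNReal.toReal_add (hGtop _) ENNReal.ofReal_ne_top, ENNReal.toReal_ofReal hc0] at h2
    have hsec : ∀ᵐ r ∂μ, AEMeasurable (fun x => Ψ (x, r)) q := by
      have := hΨ.aestronglyMeasurable.prod_swap
      filter_upwards [this.prodMk_left] with r hr
      exact hr.aemeasurable
    have hgint : ∀ᵐ r ∂μ, ∫ x, Ψ (x, r) ∂q = g r := by
      filter_upwards [hsec] with r hr
      rw [integral_eq_lintegral_of_nonneg_ae (Filter.Eventually.of_forall fun x => hΨ0 _)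
        hr.aestronglyMeasurable]
    have hmean : ∫ y, Φ y ∂(Measure.pi fun _ => q) = ∫ r, g r ∂μ := by
      rw [← he.integral_comp' (g := Φ),
        integral_prod_symm Ψ (Integrable.of_nonneg_of_le hΨ hΨ0 hΨK)]
      exact integral_congr_ae hgint
    rw [hmean]
    set m := ∫ r, g r ∂μ
    have hexpint : Integrable (fun p => Real.exp (t * (Ψ p - m))) (q.prod μ) := by
      refine Integrable.of_nonneg_of_le (K := Real.exp (|t| * (K + |m|)))
        (((hΨ.sub_const m).const_mul t).exp) (fun _ => (Real.exp_pos _).le) fun p => ?_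
      refine Real.exp_le_exp.2 ((le_abs_self _).trans ?_)
      rw [abs_mul]
      gcongr
      refine (abs_sub _ _).trans ?_
      rw [abs_of_nonneg (hΨ0 p)]
      gcongr
      exact hΨK p
    have hexpint' : Integrable (fun r => Real.exp (t * (g r - m))) μ := by
      refine Integrable.of_nonneg_of_le (K := Real.exp (|t| * (K + |m|)))
        (((hg.sub_const m).const_mul t).exp) (fun _ => (Real.exp_pos _).le) fun p => ?_
      refine Real.exp_le_exp.2 ((le_abs_self _).trans ?_)
      rw [abs_mul]
      gcongr
      refine (abs_sub _ _).trans ?_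
      rw [abs_of_nonneg (hg0 p)]
      gcongr
      exact hgK p
    set E := Real.exp ((c / 2) ^ 2 * t ^ 2 / 2)
    calc ∫ z, Real.exp (t * (Φ z - m)) ∂(Measure.pi fun _ => q)
        = ∫ p, Real.exp (t * (Ψ p - m)) ∂(q.prod μ) :=
          (he.integral_comp' (g := fun z => Real.exp (t * (Φ z - m)))).symm
      _ = ∫ r, ∫ x, Real.exp (t * (Ψ (x, r) - m)) ∂q ∂μ := integral_prod_symm _ hexpint
      _ ≤ ∫ r, E * Real.exp (t * (g r - m)) ∂μ := by
          refine integral_mono_ae hexpint.integral_prod_right (hexpint'.const_mul E) ?_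
          filter_upwards [hsec, hgint] with r hr hgr
          -- Hoeffding's lemma in the first coordinate, conditionally on r; the deviation of the
          -- partial mean g is left to the induction hypothesis.
          have h1 := integral_exp_sub_integral_le_of_forall_le_add hr (fun x y => hΨ1 x y r) t
          have h2 : ∀ x, Real.exp (t * (Ψ (x, r) - m)) =
              Real.exp (t * (Ψ (x, r) - ∫ y, Ψ (y, r) ∂q)) * Real.exp (t * (g r - m)) := by
            intro x
            rw [hgr, ← Real.exp_add]
            ring_nf
          simp only [h2]
          rw [integral_mul_const]
          gcongr
      _ = E * ∫ r, Real.exp (t * (g r - m)) ∂μ := integral_const_mul _ _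
      _ ≤ E * Real.exp (n * ((c / 2) ^ 2 * t ^ 2 / 2)) := by
          gcongr
          exact ih g hg hg0 hgK hgc
      _ = _ := by
          rw [← Real.exp_add]
          push_cast
          ring_nf

open ProbabilityTheory in
/-- **McDiarmid's inequality**. -/
theorem measure_ge_le_of_bounded_differences {Z : Type*} [MeasurableSpace Z] {q : Measure Z}
    [IsProbabilityMeasure q] {c K : ℝ} (hc0 : 0 < c) {n : ℕ} (hn : 0 < n) {Φ : (Fin n → Z) → ℝ}
    (hΦ : AEMeasurable Φ (Measure.pi fun _ => q)) (hK : ∀ z, |Φ z| ≤ K)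
    (hc : ∀ z i w, Φ z ≤ Φ (Function.update z i w) + c) {x : ℝ} (hx : 0 ≤ x) :
    (Measure.pi fun _ => q) {z | ∫ y, Φ y ∂(Measure.pi fun _ => q) + c * √(n * x / 2) ≤ Φ z} ≤
      ENNReal.ofReal (Real.exp (-x)) := by
  set μ : Measure (Fin n → Z) := Measure.pi fun _ => q
  have hint : Integrable Φ μ := Integrable.of_mem_Icc (-K) K hΦ
    (Filter.Eventually.of_forall fun z => abs_le.1 (hK z))
  set m := ∫ y, Φ y ∂μ
  have hmK : ∫ y, (Φ y + K) ∂μ = m + K := by rw [integral_add hint (integrable_const _)]; simp [m]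
  have hmgf : ∀ t : ℝ, mgf (fun z => Φ z - m) μ t ≤ Real.exp (n * ((c / 2) ^ 2 * t ^ 2 / 2)) := by
    intro t
    -- Adding K makes Φ nonnegative and leaves its deviation from the mean unchanged.
    have := integral_exp_sub_integral_le_of_bounded_differences (q := q) (c := c) (K := 2 * K) t n
      (fun z => Φ z + K) (hΦ.add_const K) (fun z => by linarith [(abs_le.1 (hK z)).1])
      (fun z => by linarith [(abs_le.1 (hK z)).2]) (fun z i w => by linarith [hc z i w])
    rw [hmK] at this
    simpa [mgf] using this
  have hexp : ∀ t, Integrable (fun z => Real.exp (t * (Φ z - m))) μ := fun t =>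
    integrable_exp_mul_of_mem_Icc (a := -K - m) (b := K - m) (hΦ.sub_const m)
      (Filter.Eventually.of_forall fun z => by
        have := abs_le.1 (hK z); constructor <;> linarith)
  have hsub : HasSubgaussianMGF (fun z => Φ z - m) (n * (c.toNNReal / 2) ^ 2) μ :=
    ⟨hexp, fun t => (hmgf t).trans_eq (by simp [hc0.le]; ring)⟩
  have h := hsub.measure_ge_le (ε := c * √(n * x / 2)) (by positivity)
  have hn' : (0 : ℝ) < n := by exact_mod_cast hn
  have hexpo : -(c * √(n * x / 2)) ^ 2 / (2 * ((n * (c.toNNReal / 2) ^ 2 : ℝ≥0) : ℝ)) = -x := by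
    rw [mul_pow, Real.sq_sqrt (by positivity)]
    simp only [NNReal.coe_mul, NNReal.coe_natCast, NNReal.coe_pow, NNReal.coe_div,
      Real.coe_toNNReal c hc0.le, NNReal.coe_ofNat]
    field_simp
  rw [hexpo] at h
  have hset : {z | m + c * √(n * x / 2) ≤ Φ z} = {z | c * √(n * x / 2) ≤ Φ z - m} := by
    ext z; simp only [Set.mem_ofPred_eq]; constructor <;> intro h <;> linarith
  rw [hset]
  exact (ENNReal.le_ofReal_iff_toReal_le (measure_ne_top _ _) (Real.exp_pos _).le).2 h

/-! ### Suprema over the class: Rademacher complexity and measurability -/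

theorem measurePreserving_comp_equiv {ι ι' Z : Type*} [Fintype ι] [Fintype ι'] [MeasurableSpace Z]
    (q : Measure Z) [SigmaFinite q] (e : ι ≃ ι') :
    MeasurePreserving (fun (z : ι' → Z) i => z (e i)) (Measure.pi fun _ => q)
      (Measure.pi fun _ => q) :=
  (measurePreserving_piCongrLeft (fun _ : ι' => q) e).symm _

/-- The supremum over `f ∈ F` of a linear combination of the risk of `f` and of the losses of `f`
at the points of a sample. -/
noncomputable def supLoss {H Z ι : Type*} [MeasurableSpace Z] [Fintype ι] (q : Measure Z)
    (F : Set H) (L : H → Z → ℝ) (c : ℝ) (a : ι → ℝ) (z : ι → Z) : ℝ :=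
  ⨆ f : F, (c * ∫ w, L f w ∂q + ∑ i, a i * L f (z i))

/-- A class of measurable losses with values in `[0, M]`. -/
structure IsBoundedLoss {H Z : Type*} [MeasurableSpace Z] (F : Set H) (L : H → Z → ℝ) (M : ℝ) :
    Prop where
  nonempty : F.Nonempty
  measurable : ∀ f ∈ F, Measurable (L f)
  nonneg : ∀ f ∈ F, ∀ z, 0 ≤ L f z
  le : ∀ f ∈ F, ∀ z, L f z ≤ M

namespace IsBoundedLoss

variable {H Z ι : Type*} [MeasurableSpace Z] [Fintype ι] {q : Measure Z}
  {F : Set H} {L : H → Z → ℝ} {M : ℝ}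

theorem supLoss_le (h : IsBoundedLoss F L M) {c : ℝ} {a : ι → ℝ} {z : ι → Z} {b : ℝ}
    (hb : ∀ f ∈ F, c * ∫ w, L f w ∂q + ∑ i, a i * L f (z i) ≤ b) : supLoss q F L c a z ≤ b := by
  have := h.nonempty.to_subtype
  exact ciSup_le fun f => hb f f.2

/-- Flipping all signs permutes the sign vectors. -/
theorem sum_supLoss_neg (z : ι → Z) [DecidableEq ι] :
    ∑ σ : ι → Bool, supLoss q F L 0 (fun i => -boolSign (σ i)) z =
      ∑ σ : ι → Bool, supLoss q F L 0 (fun i => boolSign (σ i)) z := by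
  have hinv : Function.Involutive fun (σ : ι → Bool) i => !σ i := fun σ => by simp
  rw [← Equiv.sum_comp hinv.toPerm]
  refine Finset.sum_congr rfl fun σ _ => ?_
  congr 1
  ext i
  cases hi : σ i <;> simp [boolSign, hi]

/-- The empirical Rademacher complexity of a bounded class. -/
theorem sum_supLoss_boolSign_le [DecidableEq ι] (h : IsBoundedLoss F L M) (hM : 0 ≤ M) {d : ℕ}
    (hd : d ≤ Fintype.card ι)
    (hsh : ∀ t : ℝ, 0 ≤ t → t < M → ∀ s : Finset Z,
      (∀ b ⊆ s, ∃ f ∈ F, ∀ z ∈ s, t < L f z ↔ z ∈ b) → s.card ≤ d) (z : ι → Z) :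
    ∑ σ : ι → Bool, supLoss q F L 0 (fun i => boolSign (σ i)) z ≤ 2 ^ Fintype.card ι *
      (M * √(2 * Fintype.card ι * (d * Real.log (Real.exp 1 * Fintype.card ι / d)))) := by
  classical
  have := h.nonempty.to_subtype
  -- The suprema need not be attained: near-maximizers, one for each sign vector, lose ε in total.
  refine le_of_forall_pos_le_add fun ε hε => ?_
  have hN : (0 : ℝ) < 2 ^ Fintype.card ι := by positivity
  have hex : ∀ σ : ι → Bool, ∃ f ∈ F, supLoss q F L 0 (fun i => boolSign (σ i)) z -
      ε / 2 ^ Fintype.card ι ≤ ∑ i, boolSign (σ i) * L f (z i) := by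
    intro σ
    obtain ⟨f, hf⟩ := exists_lt_of_lt_ciSup (show supLoss q F L 0 (fun i => boolSign (σ i)) z -
      ε / 2 ^ Fintype.card ι < supLoss q F L 0 (fun i => boolSign (σ i)) z from
        sub_lt_self _ (by positivity))
    refine ⟨f, f.2, ?_⟩
    simpa using hf.le
  choose f hf hsup using hex
  have hmain := sum_boolSign_mul_le hM hd (fun σ i => L (f σ) (z i))
    (fun σ i => h.nonneg _ (hf σ) _) (fun σ i => h.le _ (hf σ) _) fun t ht0 htM s hs => by
      -- Equal sample points cannot be separated, so a shattered set of indices has distinct points.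
      have hinj : Set.InjOn z s := by
        intro i hi j hj hij
        obtain ⟨σ, hσ⟩ := hs {i} (Finset.singleton_subset_iff.2 hi)
        have h1 := (hσ i hi).2 (Finset.mem_singleton_self i)
        rw [hij] at h1
        exact (Finset.mem_singleton.1 ((hσ j hj).1 h1)).symm
      rw [← Finset.card_image_of_injOn hinj]
      refine hsh t ht0 htM _ fun b _ => ?_
      obtain ⟨σ, hσ⟩ := hs (s.filter fun i => z i ∈ b) (Finset.filter_subset _ _)
      refine ⟨f σ, hf σ, fun y hy => ?_⟩
      obtain ⟨i, hi, rfl⟩ := Finset.mem_image.1 hy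
      rw [hσ i hi]
      simp [hi]
  have h2 := Finset.sum_le_sum fun σ (_ : σ ∈ Finset.univ) => hsup σ
  rw [Finset.sum_sub_distrib] at h2
  have h3 : ∑ _σ : ι → Bool, ε / 2 ^ Fintype.card ι = ε := by
    simp [Finset.card_univ]
    field_simp
  rw [h3] at h2
  linarith

variable [IsProbabilityMeasure q]

theorem integrable (h : IsBoundedLoss F L M) {f : H} (hf : f ∈ F) : Integrable (L f) q :=
  Integrable.of_nonneg_of_le (h.measurable f hf).aemeasurable (h.nonneg f hf) (h.le f hf)

theorem abs_term_le (h : IsBoundedLoss F L M) (c : ℝ) (a : ι → ℝ) (z : ι → Z) {f : H}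
    (hf : f ∈ F) :
    |c * ∫ w, L f w ∂q + ∑ i, a i * L f (z i)| ≤ (|c| + ∑ i, |a i|) * M := by
  have h1 : |∫ w, L f w ∂q| ≤ M := by
    rw [abs_of_nonneg (integral_nonneg (h.nonneg f hf))]
    calc ∫ w, L f w ∂q ≤ ∫ _w, M ∂q :=
          integral_mono (h.integrable hf) (integrable_const _) (h.le f hf)
      _ = M := by simp
  calc _ ≤ |c * ∫ w, L f w ∂q| + ∑ i, |a i * L f (z i)| :=
        (abs_add_le _ _).trans (add_le_add_right (Finset.abs_sum_le_sum_abs _ _) _)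
    _ ≤ |c| * M + ∑ i, |a i| * M := by
        simp_rw [abs_mul]
        gcongr with i
        rw [abs_of_nonneg (h.nonneg f hf _)]
        exact h.le f hf _
    _ = _ := by rw [add_mul, Finset.sum_mul]

theorem bddAbove (h : IsBoundedLoss F L M) (c : ℝ) (a : ι → ℝ) (z : ι → Z) :
    BddAbove (Set.range fun f : F => c * ∫ w, L f w ∂q + ∑ i, a i * L f (z i)) :=
  ⟨(|c| + ∑ i, |a i|) * M, by
    rintro _ ⟨f, rfl⟩
    exact (abs_le.1 (h.abs_term_le c a z f.2)).2⟩

theorem le_supLoss (h : IsBoundedLoss F L M) (c : ℝ) (a : ι → ℝ) (z : ι → Z) {f : H}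
    (hf : f ∈ F) : c * ∫ w, L f w ∂q + ∑ i, a i * L f (z i) ≤ supLoss q F L c a z :=
  le_ciSup (h.bddAbove c a z) ⟨f, hf⟩

theorem abs_supLoss_le (h : IsBoundedLoss F L M) (c : ℝ) (a : ι → ℝ) (z : ι → Z) :
    |supLoss q F L c a z| ≤ (|c| + ∑ i, |a i|) * M := by
  obtain ⟨f, hf⟩ := h.nonempty
  exact abs_le.2 ⟨(abs_le.1 (h.abs_term_le c a z hf)).1.trans (h.le_supLoss c a z hf),
    h.supLoss_le fun f hf => (abs_le.1 (h.abs_term_le c a z hf)).2⟩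

/-- A supremum exceeds t exactly when some member does, so the superlevel sets are those of
`SupMeasurable`, up to reindexing by `Fin`. -/
theorem aemeasurable_supLoss (h : IsBoundedLoss F L M) (hF : SupMeasurable q F L) (c : ℝ)
    (a : ι → ℝ) : AEMeasurable (supLoss q F L c a) (Measure.pi fun _ => q) := by
  refine NullMeasurable.aemeasurable ?_
  refine measurable_of_Ioi (α := ℝ) (δ := NullMeasurableSpace (ι → Z) (Measure.pi fun _ => q))
    fun t => ?_
  change NullMeasurableSet (supLoss q F L c a ⁻¹' Set.Ioi t) (Measure.pi fun _ => q)
  have e := Fintype.equivFin ι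
  have h1 := (hF _ (fun i => a (e.symm i)) c t).preimage
    (measurePreserving_comp_equiv q e.symm).quasiMeasurePreserving
  convert h1 using 1
  ext z
  have := h.nonempty.to_subtype
  simp only [Set.mem_preimage, Set.mem_Ioi, supLoss, lt_ciSup_iff (h.bddAbove c a z),
    Set.mem_ofPred_eq, Subtype.exists, exists_prop]
  refine exists_congr fun f => and_congr_right fun _ => ?_
  rw [← Equiv.sum_comp e.symm]

theorem integrable_supLoss (h : IsBoundedLoss F L M) (hF : SupMeasurable q F L) (c : ℝ)
    (a : ι → ℝ) : Integrable (supLoss q F L c a) (Measure.pi fun _ => q) :=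
  Integrable.of_mem_Icc _ _ (h.aemeasurable_supLoss hF c a)
    (Filter.Eventually.of_forall fun z => abs_le.1 (h.abs_supLoss_le c a z))

theorem integral_sum_eq (h : IsBoundedLoss F L M) {f : H} (hf : f ∈ F) (a : ι → ℝ) :
    ∫ z, ∑ i, a i * L f (z i) ∂(Measure.pi fun _ : ι => q) = (∑ i, a i) * ∫ w, L f w ∂q := by
  have hmp : ∀ i : ι, MeasurePreserving (Function.eval i) (Measure.pi fun _ : ι => q) q :=
    fun i => measurePreserving_eval (fun _ => q) i
  rw [integral_finsetSum, Finset.sum_mul]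
  · refine Finset.sum_congr rfl fun i _ => ?_
    rw [integral_const_mul]
    congr 1
    have := integral_map (μ := Measure.pi fun _ : ι => q) (hmp i).measurable.aemeasurable
      (h.measurable f hf).aestronglyMeasurable
    rw [(hmp i).map_eq] at this
    exact this.symm
  · intro i _
    exact ((hmp i).integrable_comp_of_integrable (h.integrable hf)).const_mul _

/-- Subadditivity of the supremum decouples the sample from the ghost sample. -/
theorem supLoss_sumElim_le (h : IsBoundedLoss F L M) (a b : ι → ℝ) (w : ι ⊕ ι → Z) :
    supLoss q F L 0 (Sum.elim a b) w ≤
      supLoss q F L 0 a (fun i => w (.inl i)) + supLoss q F L 0 b (fun i => w (.inr i)) := by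
  refine h.supLoss_le fun f hf => ?_
  have h1 := h.le_supLoss (q := q) 0 a (fun i => w (.inl i)) hf
  have h2 := h.le_supLoss (q := q) 0 b (fun i => w (.inr i)) hf
  simp only [Fintype.sum_sum_type, Sum.elim_inl, Sum.elim_inr]
  linarith

/-! ### Symmetrization -/

/-- The introduction of a ghost sample. -/
theorem integral_supLoss_le_ghost (h : IsBoundedLoss F L M) (hF : SupMeasurable q F L) :
    ∫ z, supLoss q F L (Fintype.card ι) (fun _ : ι => -1) z ∂(Measure.pi fun _ => q) ≤
      ∫ w, supLoss q F L 0 (Sum.elim (fun _ : ι => -1) fun _ : ι => 1) w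
        ∂(Measure.pi fun _ => q) := by
  set μ : Measure (ι → Z) := Measure.pi fun _ => q
  set e := MeasurableEquiv.sumPiEquivProdPi (fun _ : ι ⊕ ι => Z)
  have he : MeasurePreserving e.symm (μ.prod μ) (Measure.pi fun _ => q) :=
    measurePreserving_sumPiEquivProdPi_symm (fun _ : ι ⊕ ι => q)
  set S := supLoss q F L 0 (Sum.elim (fun _ : ι => (-1 : ℝ)) fun _ : ι => 1)
  have hint : Integrable (fun p => S (e.symm p)) (μ.prod μ) :=
    he.integrable_comp_of_integrable (h.integrable_supLoss hF _ _)
  rw [← he.integral_comp' (g := S), integral_prod _ hint]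
  refine integral_mono_ae (h.integrable_supLoss hF _ _) hint.integral_prod_left ?_
  filter_upwards [hint.prod_right_ae] with z hz
  refine h.supLoss_le fun f hf => ?_
  have hi : Integrable (fun z' : ι → Z => ∑ i, (1 : ℝ) * L f (z' i)) μ :=
    integrable_finsetSum _ fun i _ => ((measurePreserving_eval (fun _ : ι => q)
      i).integrable_comp_of_integrable (h.integrable hf)).const_mul _
  -- The risk of f is a mean over the ghost sample, and a supremum of means is at most the mean of
  -- the supremum.
  calc _ = ∫ z', ((∑ i, (-1) * L f (z i)) + ∑ i, (1 : ℝ) * L f (z' i)) ∂μ := by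
        rw [integral_add (integrable_const _) hi, h.integral_sum_eq hf]
        simp [add_comm]
    _ ≤ _ := by
        refine integral_mono ((integrable_const _).add hi) hz fun z' => ?_
        have := h.le_supLoss (q := q) 0 (Sum.elim (fun _ : ι => (-1 : ℝ)) fun _ : ι => 1)
          (e.symm (z, z')) hf
        simp only [Fintype.sum_sum_type, Sum.elim_inl, Sum.elim_inr, zero_mul, zero_add] at this
        exact this

/-- The exchange of the sample points and the ghost points selected by a sign vector. -/
theorem integral_supLoss_swap (σ : ι → Bool) :
    ∫ w, supLoss q F L 0 (Sum.elim (fun _ : ι => -1) fun _ : ι => 1) w ∂(Measure.pi fun _ => q) =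
      ∫ w, supLoss q F L 0 (Sum.elim (fun i => -boolSign (σ i)) fun i => boolSign (σ i)) w
        ∂(Measure.pi fun _ => q) := by
  let g : ι ⊕ ι → ι ⊕ ι :=
    Sum.elim (fun i => if σ i then .inl i else .inr i) (fun i => if σ i then .inr i else .inl i)
  have hg : Function.Involutive g := by
    rintro (i | i) <;> cases hi : σ i <;> simp [g, hi]
  have hmp := measurePreserving_comp_equiv q hg.toPerm
  rw [← hmp.integral_comp (MeasurableEquiv.measurableEmbedding
    (MeasurableEquiv.piCongrLeft (fun _ : ι ⊕ ι => Z) hg.toPerm).symm)]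
  refine integral_congr_ae (Filter.Eventually.of_forall fun w => ?_)
  refine iSup_congr fun f => ?_
  congr 1
  rw [← Equiv.sum_comp hg.toPerm]
  refine Finset.sum_congr rfl fun i _ => ?_
  simp only [Function.Involutive.coe_toPerm, hg i]
  congr 1
  rcases i with i | i <;> cases hi : σ i <;> simp [g, hi, boolSign]

/-- The expected uniform deviation of the empirical risk below the risk. -/
theorem integral_supLoss_le [DecidableEq ι] (h : IsBoundedLoss F L M) (hF : SupMeasurable q F L)
    (hM : 0 ≤ M) {d : ℕ} (hd : d ≤ Fintype.card ι)
    (hsh : ∀ t : ℝ, 0 ≤ t → t < M → ∀ s : Finset Z,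
      (∀ b ⊆ s, ∃ f ∈ F, ∀ z ∈ s, t < L f z ↔ z ∈ b) → s.card ≤ d) :
    ∫ z, supLoss q F L (Fintype.card ι) (fun _ : ι => -1) z ∂(Measure.pi fun _ => q) ≤
      2 * (M * √(2 * Fintype.card ι * (d * Real.log (Real.exp 1 * Fintype.card ι / d)))) := by
  set μ : Measure (ι → Z) := Measure.pi fun _ => q
  set R := M * √(2 * Fintype.card ι * (d * Real.log (Real.exp 1 * Fintype.card ι / d)))
  set I := ∫ z, supLoss q F L (Fintype.card ι) (fun _ : ι => -1) z ∂μ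
  set e := MeasurableEquiv.sumPiEquivProdPi (fun _ : ι ⊕ ι => Z)
  have he : MeasurePreserving e (Measure.pi fun _ => q) (μ.prod μ) :=
    measurePreserving_sumPiEquivProdPi (fun _ : ι ⊕ ι => q)
  have hinl : MeasurePreserving (fun (w : ι ⊕ ι → Z) i => w (.inl i)) (Measure.pi fun _ => q) μ :=
    measurePreserving_fst.comp he
  have hinr : MeasurePreserving (fun (w : ι ⊕ ι → Z) i => w (.inr i)) (Measure.pi fun _ => q) μ :=
    measurePreserving_snd.comp he
  have hint : ∀ a : ι → ℝ, Integrable (supLoss q F L 0 a) μ := h.integrable_supLoss hF 0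
  have hcomp : ∀ {k : (ι ⊕ ι → Z) → ι → Z}, MeasurePreserving k (Measure.pi fun _ => q) μ →
      ∀ a : ι → ℝ, ∫ w, supLoss q F L 0 a (k w) ∂(Measure.pi fun _ => q) =
        ∫ z, supLoss q F L 0 a z ∂μ := by
    intro k hk a
    rw [← hk.map_eq, integral_map hk.measurable.aemeasurable]
    rw [hk.map_eq]
    exact (hint a).aestronglyMeasurable
  have hcompint : ∀ {k : (ι ⊕ ι → Z) → ι → Z}, MeasurePreserving k (Measure.pi fun _ => q) μ →
      ∀ a : ι → ℝ, Integrable (fun w => supLoss q F L 0 a (k w)) (Measure.pi fun _ => q) :=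
    fun hk a => hk.integrable_comp_of_integrable (hint a)
  have hσ : ∀ σ : ι → Bool, I ≤ ∫ z, supLoss q F L 0 (fun i => -boolSign (σ i)) z ∂μ +
      ∫ z, supLoss q F L 0 (fun i => boolSign (σ i)) z ∂μ := by
    intro σ
    refine (h.integral_supLoss_le_ghost hF).trans ?_
    rw [integral_supLoss_swap σ, ← hcomp hinl, ← hcomp hinr, ← integral_add (hcompint hinl _)
      (hcompint hinr _)]
    · exact integral_mono (h.integrable_supLoss hF _ _) ((hcompint hinl _).add (hcompint hinr _))
        fun w => h.supLoss_sumElim_le _ _ w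
  -- Averaging over σ turns both halves into the same Rademacher average, whence the factor 2.
  have hsum := Finset.sum_le_sum fun σ (_ : σ ∈ Finset.univ) => hσ σ
  rw [Finset.sum_add_distrib, ← integral_finsetSum _ fun σ _ => hint _,
    ← integral_finsetSum _ fun σ _ => hint _] at hsum
  simp only [sum_supLoss_neg] at hsum
  have hR : ∫ z, ∑ σ : ι → Bool, supLoss q F L 0 (fun i => boolSign (σ i)) z ∂μ ≤
      2 ^ Fintype.card ι * R := by
    calc _ ≤ ∫ _z, 2 ^ Fintype.card ι * R ∂μ :=
          integral_mono (integrable_finsetSum _ fun σ _ => hint _) (integrable_const _)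
            fun z => h.sum_supLoss_boolSign_le hM hd hsh z
      _ = _ := by simp
  have hN : (0 : ℝ) < 2 ^ Fintype.card ι := by positivity
  have hc : ∑ _σ : ι → Bool, I = 2 ^ Fintype.card ι * I := by
    simp [Finset.card_univ]
  rw [hc] at hsum
  refine le_of_mul_le_mul_left ?_ hN
  linarith

/-! ### Deviation bounds with high probability -/

/-- A uniform deviation bound for a class of `[0, M]`-valued losses. -/
theorem measure_exists_deviation_le (h : IsBoundedLoss F L M) (hF : SupMeasurable q F L) {d n : ℕ}
    (hn : 0 < n) (hd : d ≤ n)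
    (hsh : ∀ t : ℝ, 0 ≤ t → t < M → ∀ s : Finset Z,
      (∀ b ⊆ s, ∃ f ∈ F, ∀ z ∈ s, t < L f z ↔ z ∈ b) → s.card ≤ d) {x : ℝ} (hx : 0 ≤ x) :
    (Measure.pi fun _ : Fin n => q) {z | ∃ f ∈ F,
      2 * (M * √(2 * n * (d * Real.log (Real.exp 1 * n / d)))) + M * √(n * x / 2) <
        n * ∫ w, L f w ∂q - ∑ i, L f (z i)} ≤ ENNReal.ofReal (Real.exp (-x)) := by
  obtain ⟨z₀⟩ : Nonempty Z := q.nonempty_of_neZero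
  obtain ⟨f₀, hf₀⟩ := h.nonempty
  have hM : 0 ≤ M := (h.nonneg f₀ hf₀ z₀).trans (h.le f₀ hf₀ z₀)
  -- McDiarmid's inequality is available for a positive difference bound only; for M = 0 all losses
  -- vanish.
  rcases hM.eq_or_lt with rfl | hM
  · have hz : ∀ f ∈ F, ∀ z, L f z = 0 := fun f hf z => le_antisymm (h.le f hf z) (h.nonneg f hf z)
    have : {z : Fin n → Z | ∃ f ∈ F,
        2 * (0 * √(2 * n * (d * Real.log (Real.exp 1 * n / d)))) + 0 * √(n * x / 2) <
          n * ∫ w, L f w ∂q - ∑ i, L f (z i)} = ∅ := by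
      ext z
      simp only [Set.mem_ofPred_eq, Set.mem_empty_iff_false, iff_false, not_exists, not_and]
      intro f hf
      simp [hz f hf]
    rw [this]; simp
  set Φ : (Fin n → Z) → ℝ := supLoss q F L n fun _ => -1
  have hE := h.integral_supLoss_le (ι := Fin n) hF hM.le (by simpa using hd) hsh
  simp only [Fintype.card_fin] at hE
  have hdiff : ∀ (z : Fin n → Z) i w, Φ z ≤ Φ (Function.update z i w) + M := by
    intro z i w
    refine h.supLoss_le fun f hf => ?_
    have h1 := h.le_supLoss (q := q) n (fun _ => -1) (Function.update z i w) hf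
    have h2 : ∑ j, (-1) * L f (z j) ≤ ∑ j, (-1) * L f (Function.update z i w j) + M := by
      rw [← Finset.add_sum_erase _ _ (Finset.mem_univ i),
        ← Finset.add_sum_erase Finset.univ (fun j => (-1) * L f (Function.update z i w j))
          (Finset.mem_univ i)]
      have h3 : ∑ j ∈ Finset.univ.erase i, (-1) * L f (Function.update z i w j) =
          ∑ j ∈ Finset.univ.erase i, (-1) * L f (z j) :=
        Finset.sum_congr rfl fun j hj => by
          rw [Function.update_of_ne (Finset.ne_of_mem_erase hj)]
      rw [h3, Function.update_self]
      linarith [h.nonneg f hf (z i), h.le f hf w]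
    simp only [Φ]
    linarith
  refine (measure_mono ?_).trans (measure_ge_le_of_bounded_differences hM hn
    (h.aemeasurable_supLoss hF _ _) (fun z => h.abs_supLoss_le _ _ z) hdiff hx)
  rintro z ⟨f, hf, hfz⟩
  have h1 := h.le_supLoss (q := q) n (fun _ => -1) z hf
  simp only [Set.mem_ofPred_eq]
  have h2 : n * ∫ w, L f w ∂q - ∑ i, L f (z i) =
      n * ∫ w, L f w ∂q + ∑ i, (-1) * L f (z i) := by
    simp; ring
  rw [h2] at hfz
  linarith

/-- A one-sided Hoeffding bound for one member of a bounded class. -/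
theorem measure_sum_deviation_le (h : IsBoundedLoss F L M) {n : ℕ} (hn : 0 < n) {f : H}
    (hf : f ∈ F) {x : ℝ} (hx : 0 ≤ x) :
    (Measure.pi fun _ : Fin n => q) {z |
      M * √(n * x / 2) < ∑ i, L f (z i) - n * ∫ w, L f w ∂q} ≤ ENNReal.ofReal (Real.exp (-x)) := by
  obtain ⟨z₀⟩ : Nonempty Z := q.nonempty_of_neZero
  have hM : 0 ≤ M := (h.nonneg f hf z₀).trans (h.le f hf z₀)
  rcases hM.eq_or_lt with rfl | hM
  · have hz : ∀ z, L f z = 0 := fun z => le_antisymm (h.le f hf z) (h.nonneg f hf z)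
    simp [hz]
  have hdiff : ∀ (z : Fin n → Z) i w,
      ∑ j, L f (z j) ≤ ∑ j, L f (Function.update z i w j) + M := by
    intro z i w
    rw [← Finset.add_sum_erase _ _ (Finset.mem_univ i),
      ← Finset.add_sum_erase Finset.univ (fun j => L f (Function.update z i w j))
        (Finset.mem_univ i)]
    have h3 : ∑ j ∈ Finset.univ.erase i, L f (Function.update z i w j) =
        ∑ j ∈ Finset.univ.erase i, L f (z j) :=
      Finset.sum_congr rfl fun j hj => by
        rw [Function.update_of_ne (Finset.ne_of_mem_erase hj)]
    rw [h3, Function.update_self]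
    linarith [h.nonneg f hf w, h.le f hf (z i)]
  have hmeas : Measurable fun z : Fin n → Z => ∑ j, L f (z j) :=
    Finset.measurable_sum _ fun j _ => (h.measurable f hf).comp (measurable_pi_apply j)
  have hb : ∀ z : Fin n → Z, |∑ j, L f (z j)| ≤ n * M := fun z => by
    rw [abs_of_nonneg (Finset.sum_nonneg fun j _ => h.nonneg f hf _)]
    exact (Finset.sum_le_sum fun j _ => h.le f hf (z j)).trans_eq (by simp)
  have hE := h.integral_sum_eq (q := q) (ι := Fin n) hf fun _ => 1
  simp only [one_mul, Finset.sum_const, Finset.card_univ, Fintype.card_fin, nsmul_eq_mul,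
    mul_one] at hE
  refine (measure_mono ?_).trans
    (measure_ge_le_of_bounded_differences hM hn hmeas.aemeasurable hb hdiff hx)
  intro z hz
  simp only [Set.mem_ofPred_eq] at hz ⊢
  rw [hE]
  linarith

end IsBoundedLoss

/-! ### Almost everywhere bounds: truncation -/

theorem ae_pi_forall {ι Z : Type*} [Fintype ι] [MeasurableSpace Z] {q : Measure Z}
    [IsProbabilityMeasure q] {p : Z → Prop} (hp : ∀ᵐ z ∂q, p z) :
    ∀ᵐ z ∂(Measure.pi fun _ : ι => q), ∀ i, p (z i) :=
  ae_all_iff.2 fun i => (measurePreserving_eval (fun _ : ι => q) i).quasiMeasurePreserving.ae hp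

/-- A class of measurable nonnegative losses that are simultaneously at most `M`, almost
everywhere. -/
structure IsAEBoundedLoss {H Z : Type*} [MeasurableSpace Z] (q : Measure Z) (F : Set H)
    (L : H → Z → ℝ) (M : ℝ) : Prop where
  nonempty : F.Nonempty
  measurable : ∀ f ∈ F, Measurable (L f)
  nonneg : ∀ f ∈ F, ∀ z, 0 ≤ L f z
  ae_le : ∀ᵐ z ∂q, ∀ f ∈ F, L f z ≤ M

namespace IsAEBoundedLoss

variable {H Z : Type*} [MeasurableSpace Z] {q : Measure Z} {F : Set H}
  {L : H → Z → ℝ} {M : ℝ}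

theorem integral_min (h : IsAEBoundedLoss q F L M) {f : H} (hf : f ∈ F) :
    ∫ w, min (L f w) M ∂q = ∫ w, L f w ∂q :=
  integral_congr_ae (h.ae_le.mono fun _ hz => min_eq_left (hz f hf))

variable [IsProbabilityMeasure q]

theorem bound_nonneg (h : IsAEBoundedLoss q F L M) : 0 ≤ M := by
  obtain ⟨z, hz⟩ := h.ae_le.exists
  obtain ⟨f, hf⟩ := h.nonempty
  exact (h.nonneg f hf z).trans (hz f hf)

theorem integrable (h : IsAEBoundedLoss q F L M) {f : H} (hf : f ∈ F) : Integrable (L f) q :=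
  Integrable.of_mem_Icc 0 M (h.measurable f hf).aemeasurable
    (h.ae_le.mono fun z hz => ⟨h.nonneg f hf z, hz f hf⟩)

/-- Truncation at the almost everywhere bound. -/
theorem isBoundedLoss_min (h : IsAEBoundedLoss q F L M) :
    IsBoundedLoss F (fun f z => min (L f z) M) M where
  nonempty := h.nonempty
  measurable f hf := (h.measurable f hf).min measurable_const
  nonneg f hf z := le_min (h.nonneg f hf z) h.bound_nonneg
  le _ _ _ := min_le_right _ _

/-- One null set serves all f at once, so truncation changes the sets in question by null sets only,
even for uncountable `F`. -/
theorem supMeasurable_min (h : IsAEBoundedLoss q F L M) (hF : SupMeasurable q F L) :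
    SupMeasurable q F fun f z => min (L f z) M := by
  intro m a c t
  refine (hF m a c t).congr ?_
  filter_upwards [ae_pi_forall h.ae_le] with z hz
  refine propext (exists_congr fun f => and_congr_right fun hf => ?_)
  simp only [h.integral_min hf, min_eq_left (hz _ f hf)]

/-- The uniform deviation bound for a class of losses that are bounded almost everywhere. -/
theorem measure_exists_deviation_le (h : IsAEBoundedLoss q F L M) (hF : SupMeasurable q F L)
    {d n : ℕ} (hn : 0 < n) (hd : d ≤ n)
    (hsh : ∀ (t : ℝ) (s : Finset Z),
      (∀ b ⊆ s, ∃ f ∈ F, ∀ z ∈ s, t < L f z ↔ z ∈ b) → s.card ≤ d) {x : ℝ} (hx : 0 ≤ x) :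
    (Measure.pi fun _ : Fin n => q) {z | ∃ f ∈ F,
      2 * (M * √(2 * n * (d * Real.log (Real.exp 1 * n / d)))) + M * √(n * x / 2) <
        n * ∫ w, L f w ∂q - ∑ i, L f (z i)} ≤ ENNReal.ofReal (Real.exp (-x)) := by
  refine (measure_mono_ae ?_).trans (h.isBoundedLoss_min.measure_exists_deviation_le
    (h.supMeasurable_min hF) hn hd (fun t _ htM s hs => hsh t s ?_) hx)
  · filter_upwards [ae_pi_forall h.ae_le] with z hz
    rintro ⟨f, hf, hfz⟩
    refine ⟨f, hf, ?_⟩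
    simpa only [h.integral_min hf, min_eq_left (hz _ f hf)] using hfz
  · simpa only [lt_min_iff, htM, and_true] using hs

theorem measure_sum_deviation_le (h : IsAEBoundedLoss q F L M) {n : ℕ} (hn : 0 < n) {f : H}
    (hf : f ∈ F) {x : ℝ} (hx : 0 ≤ x) :
    (Measure.pi fun _ : Fin n => q) {z |
      M * √(n * x / 2) < ∑ i, L f (z i) - n * ∫ w, L f w ∂q} ≤ ENNReal.ofReal (Real.exp (-x)) := by
  refine (measure_mono_ae ?_).trans (h.isBoundedLoss_min.measure_sum_deviation_le hn hf hx)
  filter_upwards [ae_pi_forall h.ae_le] with z hz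
  intro hfz
  have hfz : _ < _ := hfz
  change _ < _
  simpa only [h.integral_min hf, min_eq_left (hz _ f hf)] using hfz

end IsAEBoundedLoss

/-! ### Pseudo-dimension and assembly of the four deviations -/

/-- Sets shattered by the superlevel sets of a class at one level have at most as many points as
the pseudo-dimension of the class. -/
theorem card_le_of_pseudoDim_eq {H Z W : Type*} {F : Set H} {k : H → W → ℝ} {d : ℕ}
    (hd : pseudoDim {g : W → ℝ | ∃ f ∈ F, g = k f} = d) (p : Z → W) (t : ℝ) (s : Finset Z)
    (hs : ∀ b ⊆ s, ∃ f ∈ F, ∀ z ∈ s, t < k f (p z) ↔ z ∈ b) : s.card ≤ d := by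
  classical
  -- The map p will forget the endpoint on which the loss does not depend; points that it identifies
  -- cannot be separated by the class.
  have hinj : Set.InjOn p s := by
    intro x hx y hy hxy
    obtain ⟨f, -, hf⟩ := hs {x} (Finset.singleton_subset_iff.2 hx)
    have h1 := (hf x hx).2 (Finset.mem_singleton_self x)
    rw [hxy] at h1
    exact (Finset.mem_singleton.1 ((hf y hy).1 h1)).symm
  have hps : PseudoShatters {g : W → ℝ | ∃ f ∈ F, g = k f} (s.image p) := by
    refine ⟨fun _ => t, fun b _ => ?_⟩
    obtain ⟨f, hf, hfb⟩ := hs (s.filter fun z => p z ∈ b) (Finset.filter_subset _ _)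
    refine ⟨k f, ⟨f, hf, rfl⟩, fun w hw => ?_⟩
    obtain ⟨z, hz, rfl⟩ := Finset.mem_image.1 hw
    rw [hfb z hz]
    simp [hz]
  have h : ((s.image p).card : ℕ∞) ≤ d := by
    rw [← hd]
    exact le_iSup₂ (f := fun (s : Finset W)
      (_ : PseudoShatters {g : W → ℝ | ∃ f ∈ F, g = k f} s) => (s.card : ℕ∞)) _ hps
  rw [Finset.card_image_of_injOn hinj] at h
  exact_mod_cast h

theorem sqrt_two_mul_mul_eq {n : ℝ} (hn : 0 < n) (a b : ℝ) :
    √(2 * n * (a * b)) = n * √(2 * a * b / n) := by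
  rw [show 2 * n * (a * b) = n ^ 2 * (2 * a * b / n) by field_simp, Real.sqrt_mul (by positivity),
    Real.sqrt_sq hn.le]

theorem sqrt_mul_div_two_eq {n : ℝ} (hn : 0 < n) (x : ℝ) :
    √(n * x / 2) = n * √(x / (2 * n)) := by
  rw [show n * x / 2 = n ^ 2 * (x / (2 * n)) by field_simp, Real.sqrt_mul (by positivity),
    Real.sqrt_sq hn.le]

theorem mainTheorem1 {X : Type*} [MeasurableSpace X] (Y : Set ℝ)
    -- the joint law of an instance, its true label and the two endpoints of its interval
    (P : Measure (X × Y × Y × Y)) [IsProbabilityMeasure P]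
    (hP : ∀ᵐ w ∂P, (w.2.2.1 : ℝ) ≤ w.2.1 ∧ (w.2.1 : ℝ) ≤ w.2.2.2)
    -- the hypothesis space
    (F : Set (X → ℝ)) (hF : ∀ f ∈ F, Measurable f)
    (hleft : SupMeasurable (intervalLaw P) F fun f z => leftLoss f (z.1, z.2.1))
    (hright : SupMeasurable (intervalLaw P) F fun f z => rightLoss f (z.1, z.2.2))
    -- the optimal model for fully labelled data
    (loss : ℝ → ℝ → ℝ≥0) (hloss : Measurable (Function.uncurry loss))
    (fstar : X → ℝ) (hfstar : fstar ∈ F)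
    (hfstar_min : IsMinOn (expectedRisk loss (labelledLaw P)) F fstar)
    (M M' : ℝ)
    (hbound : ∀ᵐ z ∂(intervalLaw P), ∀ f ∈ F,
      leftLoss f (z.1, z.2.1) ≤ M ∧ rightLoss f (z.1, z.2.2) ≤ M')
    (d d' : ℕ)
    (hd : pseudoDim {g : X × Y → ℝ | ∃ f ∈ F, g = leftLoss f} = d)
    (hd' : pseudoDim {g : X × Y → ℝ | ∃ f ∈ F, g = rightLoss f} = d')
    (n : ℕ) (hn : 1 ≤ n) (hdn : d ≤ n) (hdn' : d' ≤ n)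
    (δ : ℝ) (hδ : 0 < δ) (hδ_lt : δ < 1)
    -- an empirical risk minimizer, as a function of the sample
    (fhat : (Fin n → X × Y × Y) → X → ℝ)
    (hfhat : ∀ᵐ z ∂(Measure.pi fun _ : Fin n => intervalLaw P),
      fhat z ∈ F ∧ IsMinOn (empiricalSurrogateRisk z) F (fhat z)) :
    (Measure.pi fun _ : Fin n => intervalLaw P)
      {z | ¬ (surrogateRisk (intervalLaw P) (fhat z) - surrogateRisk (intervalLaw P) fstar ≤
        2 * M * √(2 * d * Real.log (Real.exp 1 * n / d) / n)
          + 2 * M' * √(2 * d' * Real.log (Real.exp 1 * n / d') / n)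
          + 2 * (M + M') * √(Real.log (4 / δ) / (2 * n)))}
      ≤ ENNReal.ofReal δ := by
  have hq : IsProbabilityMeasure (intervalLaw P) :=
    Measure.isProbabilityMeasure_map (by fun_prop)
  set q := intervalLaw P
  set μ : Measure (Fin n → X × Y × Y) := Measure.pi fun _ => q
  set A : (X → ℝ) → X × Y × Y → ℝ := fun f z => leftLoss f (z.1, z.2.1)
  set B : (X → ℝ) → X × Y × Y → ℝ := fun f z => rightLoss f (z.1, z.2.2)
  have hA : IsAEBoundedLoss q F A M :=
    { nonempty := ⟨fstar, hfstar⟩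
      measurable := fun f hf => by
        have := hF f hf
        simp only [A, leftLoss]
        fun_prop
      nonneg := fun f _ z => le_max_right _ _
      ae_le := hbound.mono fun z hz f hf => (hz f hf).1 }
  have hB : IsAEBoundedLoss q F B M' :=
    { nonempty := ⟨fstar, hfstar⟩
      measurable := fun f hf => by
        have := hF f hf
        simp only [B, rightLoss]
        fun_prop
      nonneg := fun f _ z => le_max_right _ _
      ae_le := hbound.mono fun z hz f hf => (hz f hf).2 }
  have hloss_eq : ∀ (f : X → ℝ) (z : X × Y × Y),
      surrogateLoss (f z.1) (z.2.1 : ℝ) (z.2.2 : ℝ) = A f z + B f z := fun f z => by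
    simp only [surrogateLoss, A, B, leftLoss, rightLoss, max_comm]
  have hrisk : ∀ f ∈ F, surrogateRisk q f = ∫ w, A f w ∂q + ∫ w, B f w ∂q := fun f hf => by
    simp only [surrogateRisk, hloss_eq]
    exact integral_add (hA.integrable hf) (hB.integrable hf)
  have hemp : ∀ (z : Fin n → X × Y × Y) (f : X → ℝ),
      empiricalSurrogateRisk z f = ∑ i, A f (z i) + ∑ i, B f (z i) := fun z f => by
    simp only [empiricalSurrogateRisk, hloss_eq, Finset.sum_add_distrib]
  -- Chosen so that each of the four bad events has probability at most exp(-x) = δ/4.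
  set x := Real.log (4 / δ)
  have hx : 0 ≤ x := Real.log_nonneg (by rw [le_div_iff₀ hδ]; linarith)
  have hexp : Real.exp (-x) = δ / 4 := by
    rw [Real.exp_neg, Real.exp_log (by positivity), inv_div]
  have hn0 : 0 < n := hn
  have hn' : (0 : ℝ) < n := by exact_mod_cast hn0
  have h1 := hA.measure_exists_deviation_le hleft hn0 hdn
    (card_le_of_pseudoDim_eq hd fun z : X × Y × Y => (z.1, z.2.1)) hx
  have h2 := hB.measure_exists_deviation_le hright hn0 hdn'
    (card_le_of_pseudoDim_eq hd' fun z : X × Y × Y => (z.1, z.2.2)) hx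
  have h3 := hA.measure_sum_deviation_le hn0 hfstar hx
  have h4 := hB.measure_sum_deviation_le hn0 hfstar hx
  rw [hexp] at h1 h2 h3 h4
  simp only [sqrt_two_mul_mul_eq hn', sqrt_mul_div_two_eq hn'] at h1 h2 h3 h4
  have hδ4 : ENNReal.ofReal δ = ENNReal.ofReal (δ / 4) + ENNReal.ofReal (δ / 4) +
      (ENNReal.ofReal (δ / 4) + ENNReal.ofReal (δ / 4)) := by
    rw [← ENNReal.ofReal_add (by positivity) (by positivity),
      ← ENNReal.ofReal_add (by positivity) (by positivity)]
    ring_nf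
  rw [hδ4]
  refine le_trans ?_ (add_le_add (add_le_add h1 h2) (add_le_add h3 h4))
  refine le_trans (measure_mono_ae ?_) ((measure_union_le _ _).trans
    (add_le_add (measure_union_le _ _) (measure_union_le _ _)))
  filter_upwards [hfhat] with z hz hbad
  by_contra hnot
  apply hbad
  have hnot' : ¬ (((_ ∨ _) ∨ (_ ∨ _)) : Prop) := hnot
  simp only [not_or, Set.mem_ofPred_eq] at hnot'
  obtain ⟨⟨g1, g2⟩, g3, g4⟩ := hnot'
  have k1 := not_lt.1 fun h => g1 ⟨fhat z, hz.1, h⟩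
  have k2 := not_lt.1 fun h => g2 ⟨fhat z, hz.1, h⟩
  have k3 := not_lt.1 g3
  have k4 := not_lt.1 g4
  have k5 : empiricalSurrogateRisk z (fhat z) ≤ empiricalSurrogateRisk z fstar := hz.2 hfstar
  rw [hemp, hemp] at k5
  rw [hrisk _ hz.1, hrisk _ hfstar]
  -- On the scale of sums, the four bounds and the minimality of `fhat` add up; the terms with
  -- log(4/δ) occur once for `fhat` and once for `fstar`, whence 2(M + M').
  refine le_of_mul_le_mul_left ?_ hn'
  linarith
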